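/- Let $k$ be an algebraically closed field and let $A$ be a $k$-qurve, that is, a finitely generated associative unital $k$-algebra such that for every $k$-algebra $B$ and every nilpotent two-sided ideal $I \subset B$, each $k$-algebra morphism $A \to B/I$ lifts to a $k$-algebra morphism $A \to B$. For $n \in \mathbb{N}$ let $\mathrm{rep}_n A = \mathrm{Hom}_{k\text{-alg}}(A, M_n(k))$ with its Zariski topology; write $\mathrm{rep}_\alpha A$ for its connected components, and call the labels $\alpha$ dimension vectors. An $n$-dimensional left $A$-module lies in $\mathrm{rep}_\alpha A$ if the representation it gives in some $k$-basis does. For a finite dimensional left $A$-module $M$, let $M^{ss}$ be the direct sum of its Jordan–Hölder factors; if $M^{ss} \cong S_1^{\oplus e_1} \oplus \dots \oplus S_r^{\oplus e_r}$ with the $S_i$ simple and pairwise non-isomorphic, $e_i \geq 1$, and $S_i$ in $\mathrm{rep}_{\beta_i} A$, then the representation type of $M$ is $\tau(M) = (e_1,\beta_1; \dots; e_r,\beta_r)$, up to permutation of the terms $(e_i,\beta_i)$. Then for all finite dimensional left $A$-modules $M, N$ the $k$-spaces $\mathrm{Hom}_A(M,N)$ and $\mathrm{Ext}^1_A(M,N)$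 are finite dimensional, and the Euler form $$\chi_A(M,N) = \dim_k \mathrm{Hom}_A(M,N) - \dim_k \mathrm{Ext}^1_A(M,N)$$ depends only on the representation types $\tau(M)$ and $\tau(N)$: if $\tau(M) = \tau(M')$ and $\tau(N) = \tau(N')$, then $\chi_A(M,N) = \chi_A(M',N')$. In particular, $\chi_A(S,T)$ is constant for $S$ ranging over the simple modules in $\mathrm{rep}_\alpha A$ and $T$ over the simple modules in $\mathrm{rep}_\beta A$, for all dimension vectors $\alpha, \beta$; and $\chi_A(M,N) = \chi_A(M^{ss},N^{ss})$. -/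

import Mathlib

open CategoryTheory
open scoped ModuleCat

universe v u

namespace Qurve

/-- A `k`-qurve (quasi-free, or formally smooth, algebra): a finitely generated associative unital
`k`-algebra with the lifting property modulo nilpotent two-sided ideals (`I ^ m = 0`, that is, all products of `m`
elements of `I` vanish) in the category of all (not necessarily commutative) `k`-algebras. -/
structure IsQurve (k : Type u) (A : Type v) [Field k] [Ring A] [Algebra k A] : Prop where
  finiteType : Algebra.FiniteType k A
  lift : ∀ (B : Type v) [Ring B] [Algebra k B] (I : Ideal B) [I.IsTwoSided],
    (∃ m : ℕ, ∀ l : List B, l.length = m → (∀ x ∈ l, x ∈ I) → l.prod = 0) → ∀ f : A →ₐ[k] B ⧸ I,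
      ∃ g : A →ₐ[k] B, (Ideal.Quotient.mkₐ k I).comp g = f

section Components

variable (k : Type u) [Field k] (A : Type v) [Ring A] [Algebra k A]

/-- The variety of `n`-dimensional representations of `A`, through its `k`-points: the algebra
morphisms from `A` to the `n × n` matrices. -/
def Rep (n : ℕ) : Type (max u v) := A →ₐ[k] Matrix (Fin n) (Fin n) k

/-- The coordinate functions `ρ ↦ ρ(a) i j` on the representation variety, which generate its
coordinate ring. -/
def Rep.coord {n : ℕ} (ρ : Rep k A n) (x : A × Fin n × Fin n) : k :=
  (show A →ₐ[k] Matrix (Fin n) (Fin n) k from ρ) x.1 x.2.1 x.2.2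

/-- The Zariski topology on the representation variety: it is generated by the loci where a given
polynomial in the coordinate functions does not vanish. -/
instance (n : ℕ) : TopologicalSpace (Rep k A n) :=
  TopologicalSpace.generateFrom
    {U | ∃ p : MvPolynomial (A × Fin n × Fin n) k, U = {ρ | MvPolynomial.eval (ρ.coord k A) p ≠ 0}}

/-- The set `comp(A)` of dimension vectors: pairs of a total dimension `n` and a connected component
of the variety of `n`-dimensional representations. -/
def Comp : Type (max u v) := Σ n : ℕ, ConnectedComponents (Rep k A n)

end Components

section Modules

variable (k : Type u) [Field k] {A : Type v} [Ring A] [Algebra k A]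

/-- The point of the representation variety given by a left `A`-module with a `k`-basis. -/
noncomputable def matrixRep (M : ModuleCat.{v} A) {n : ℕ} (b : Module.Basis (Fin n) k M) :
    Rep k A n :=
  ((LinearMap.toMatrixAlgEquiv b : Module.End k M →ₐ[k] Matrix (Fin n) (Fin n) k).comp
    (Algebra.lsmul k k M : A →ₐ[k] Module.End k M) : A →ₐ[k] Matrix (Fin n) (Fin n) k)

/-- `M` belongs to the component `α` (so that `M` is finite dimensional, of dimension `|α|`). -/
def LiesIn (M : ModuleCat.{v} A) (α : Comp k A) : Prop :=
  ∃ b : Module.Basis (Fin α.1) k M, ConnectedComponents.mk (matrixRep k M b) = α.2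

/-- The `i`-th factor of a composition series. -/
abbrev factor {M : ModuleCat.{v} A} (s : CompositionSeries (Submodule A M)) (i : Fin s.length) :
    Type v :=
  s i.succ ⧸ (s i.castSucc).submoduleOf (s i.succ)

/-- `L` is (isomorphic to) the semi-simplification of `M`: the direct sum of the factors of a
composition series of `M`. -/
def IsSemisimplification (M L : ModuleCat.{v} A) : Prop :=
  ∃ s : CompositionSeries (Submodule A M), s.head = ⊥ ∧ s.last = ⊤ ∧
    Nonempty (L ≃ₗ[A] ((i : Fin s.length) → factor s i))

/-- `M` has representation type `τ = (e₁, β₁; …; eᵣ, βᵣ)` (up to permutation): the isotypical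
decomposition of its semi-simplification is `S₁^{e₁} ⊕ … ⊕ Sᵣ^{eᵣ}`, with `Sᵢ` in the
component `βᵢ`. -/
def HasRepType (M : ModuleCat.{v} A) (τ : Multiset (ℕ × Comp k A)) : Prop :=
  ∃ (r : ℕ) (S : Fin r → ModuleCat.{v} A) (e : Fin r → ℕ) (β : Fin r → Comp k A),
    (∀ i, IsSimpleModule A (S i)) ∧
    (∀ i j, i ≠ j → IsEmpty (S i ≃ₗ[A] S j)) ∧
    (∀ i, 0 < e i) ∧
    (∀ i, LiesIn k (S i) (β i)) ∧
    IsSemisimplification M (ModuleCat.of A ((i : Fin r) → Fin (e i) → S i)) ∧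
    τ = (Finset.univ : Finset (Fin r)).val.map fun i => (e i, β i)

theorem finite_of_surjective {M : ModuleCat.{v} A} [Module.Finite k M] (N : Submodule A M)
    (X : ModuleCat.{v} A) (f : N →ₗ[A] X) (hf : Function.Surjective f) : Module.Finite k X := by
  have : Module.Finite k N := Module.Finite.of_injective (N.subtype.restrictScalars k)
    Subtype.val_injective
  exact Module.Finite.of_surjective (f.restrictScalars k) hf

/-- Every finite dimensional module has a representation type. -/
theorem exists_hasRepType (M : ModuleCat.{v} A) [Module.Finite k M] :
    ∃ τ : Multiset (ℕ × Comp k A), HasRepType k M τ := by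
  classical
  have : IsNoetherian A M := isNoetherian_of_tower k inferInstance
  have : IsArtinian A M := isArtinian_of_tower k inferInstance
  obtain ⟨s, hs0, hs1⟩ := exists_compositionSeries_of_isNoetherian_isArtinian A M
  let R : Setoid (Fin s.length) :=
    { r := fun i j => Nonempty (factor s i ≃ₗ[A] factor s j)
      iseqv := ⟨fun _ => ⟨LinearEquiv.refl A _⟩, fun ⟨f⟩ => ⟨f.symm⟩,
        fun ⟨f⟩ ⟨g⟩ => ⟨f.trans g⟩⟩ }
  let Q := Quotient R
  let q : Fin (Fintype.card Q) → Q := (Fintype.equivFin Q).symm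
  let F : Fin (Fintype.card Q) → Type := fun j => {i : Fin s.length // Quotient.mk R i = q j}
  let S : Fin (Fintype.card Q) → ModuleCat.{v} A := fun j => ModuleCat.of A (factor s (q j).out)
  have hfin : ∀ j, Module.Finite k (S j) := by
    intro j
    exact finite_of_surjective k (s (q j).out.succ) (S j)
      (((s (q j).out.castSucc).submoduleOf (s (q j).out.succ)).mkQ) (Submodule.mkQ_surjective _)
  have hlie : ∀ j, ∃ β : Comp k A, LiesIn k (S j) β := by
    intro j
    have := hfin j
    exact ⟨⟨Module.finrank k (S j),
      ConnectedComponents.mk (matrixRep k (S j) (Module.finBasis k (S j)))⟩,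
      Module.finBasis k (S j), rfl⟩
  choose β hβ using hlie
  refine ⟨_, Fintype.card Q, S, fun j => Fintype.card (F j), β, ?_, ?_, ?_, hβ, ?_, rfl⟩
  · intro j
    have h := s.step (q j).out
    exact (covBy_iff_quot_is_simple (CovBy.le h)).1 h
  · intro i j hij
    refine ⟨fun f => hij ?_⟩
    have h : Quotient.mk R (q i).out = Quotient.mk R (q j).out := Quotient.sound ⟨f⟩
    rw [Quotient.out_eq, Quotient.out_eq] at h
    exact (Fintype.equivFin Q).symm.injective h
  · intro j
    exact Fintype.card_pos_iff.2 ⟨⟨(q j).out, Quotient.out_eq _⟩⟩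
  · refine ⟨s, hs0, hs1, ?_⟩
    let E : (Σ j, Fin (Fintype.card (F j))) ≃ Fin s.length :=
      (Equiv.sigmaCongrRight fun j => (Fintype.equivFin (F j)).symm).trans
        (((Fintype.equivFin Q).symm.sigmaCongrLeft
          (β := fun x : Q => {i : Fin s.length // Quotient.mk R i = x})).trans
            (Equiv.sigmaFiberEquiv (Quotient.mk R)))
    have hE : ∀ p, Quotient.mk R (E p) = q p.1 := fun p =>
      ((Fintype.equivFin (F p.1)).symm p.2).2
    have hiso : ∀ p, Nonempty (S p.1 ≃ₗ[A] factor s (E p)) := by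
      intro p
      exact Quotient.exact ((Quotient.out_eq (q p.1)).trans (hE p).symm)
    exact ⟨((LinearEquiv.piCurry A (fun (j : Fin (Fintype.card Q))
        (_ : Fin (Fintype.card (F j))) => (S j : Type v))).symm.trans
      (LinearEquiv.piCongrRight fun p => (hiso p).some)).trans
        (LinearEquiv.piCongrLeft A (fun i => factor s i) E)⟩

/-- The Euler form `dim Hom_A(M, N) - dim Ext¹_A(M, N)`. -/
noncomputable def eulerForm (M N : ModuleCat.{v} A) : ℤ :=
  (Module.finrank k (M ⟶ N) : ℤ) - (Module.finrank k (Abelian.Ext M N 1) : ℤ)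

end Modules

end Qurve

/-! Write `Der(M, N)` for the derivations of `A` with values in `Hom_k(M, N)`. The sequence `0 →
Hom_A(M, N) → Hom_k(M, N) → Der(M, N) → Ext¹_A(M, N) → 0`, whose middle map sends a linear map to
its inner derivation, is exact, so `χ(M, N) = dim M · dim N - dim Der(M, N)` (`eulerForm_eq`). It
remains to control `dim Der`.

Present `A` as `F/I` with `F` free on a finite set `X`. The lifting property splits `F/I² → A`, and
derivations of `F` with values in an `A`-bimodule kill `I²`. Hence `Der(M, N)` is a retract of
`Hom_k(M, N)^X`, the image of an idempotent (`derivationsProj`). Two facts follow. The idempotent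
depends polynomially on the two representations, and nearby idempotents have equal rank, so `dim
Der` is constant on connected components (`isLocallyConstant_finrank_derivations`). And `Der` is
exact in each argument, because lifting derivations reduces to lifting linear maps
(`derivationsMap_surjective`), so `χ` is additive on short exact sequences.

An additive function is determined by composition factors, and `χ` sees a factor only through its
component. This gives all the claims. -/

namespace Qurve

/-! ### Derivations with values in `Hom_k(M, N)`; the free algebra and descent along a square-zero
section. -/

section Derivations

variable {k : Type*} [Field k] {A B : Type*} [Ring A] [Algebra k A] [Ring B] [Algebra k B]
  {M M' N N' : Type*} [AddCommGroup M] [Module k M] [AddCommGroup M'] [Module k M']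
  [AddCommGroup N] [Module k N] [AddCommGroup N'] [Module k N']

/-- The derivations of `A` with values in the bimodule `Hom_k(M, N)`. -/
def derivations (r : A →ₐ[k] Module.End k M) (l : A →ₐ[k] Module.End k N) :
    Submodule k (A →ₗ[k] M →ₗ[k] N) where
  carrier := {D | ∀ a b, D (a * b) = l a ∘ₗ D b + D a ∘ₗ r b}
  zero_mem' a b := by simp
  add_mem' {D E} hD hE a b := by
    simp only [LinearMap.add_apply, hD a b, hE a b, LinearMap.comp_add, LinearMap.add_comp]
    abel
  smul_mem' c D hD a b := by
    simp only [LinearMap.smul_apply, hD a b, LinearMap.comp_smul, LinearMap.smul_comp, smul_add]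

variable {r : A →ₐ[k] Module.End k M} {l : A →ₐ[k] Module.End k N}
  {r' : A →ₐ[k] Module.End k M'} {l' : A →ₐ[k] Module.End k N'}

theorem derivations_apply_mul (D : derivations r l) (a b : A) :
    D.1 (a * b) = l a ∘ₗ D.1 b + D.1 a ∘ₗ r b := D.2 a b

theorem derivations_apply_one (D : derivations r l) : D.1 1 = 0 := by
  have h := derivations_apply_mul D 1 1
  simp only [mul_one, map_one, Module.End.one_eq_id, LinearMap.id_comp, LinearMap.comp_id] at h
  exact left_eq_add.1 h

/-- Derivations with values in `Hom_k(M, N)` induce derivations with values in `Hom_k(M', N')` along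
module homomorphisms `M' → M` and `N → N'`. -/
def derivationsMap (h : M' →ₗ[k] M) (g : N →ₗ[k] N') (hh : ∀ a, r a ∘ₗ h = h ∘ₗ r' a)
    (hg : ∀ a, g ∘ₗ l a = l' a ∘ₗ g) : derivations r l →ₗ[k] derivations r' l' where
  toFun D := ⟨(LinearMap.lcomp k N' h ∘ₗ LinearMap.compRight k g) ∘ₗ D.1, fun a b => by
    have e (x) : g (l a x) = l' a (g x) := LinearMap.congr_fun (hg a) x
    have e' (x) : r b (h x) = h (r' b x) := LinearMap.congr_fun (hh b) x
    ext x
    simp [derivations_apply_mul, e, e']⟩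
  map_add' D E := by ext; simp
  map_smul' c D := by ext; simp

@[simp]
theorem derivationsMap_apply (h : M' →ₗ[k] M) (g : N →ₗ[k] N') (hh : ∀ a, r a ∘ₗ h = h ∘ₗ r' a)
    (hg : ∀ a, g ∘ₗ l a = l' a ∘ₗ g) (D : derivations r l) (a : A) (x : M') :
    (derivationsMap h g hh hg D).1 a x = g (D.1 a (h x)) := rfl

/-- Isomorphic modules have isomorphic spaces of derivations. -/
def derivationsCongr (h : M' ≃ₗ[k] M) (g : N ≃ₗ[k] N') (hh : ∀ a, r a ∘ₗ h = h ∘ₗ r' a)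
    (hg : ∀ a, g ∘ₗ l a = l' a ∘ₗ g) : derivations r l ≃ₗ[k] derivations r' l' :=
  LinearEquiv.ofLinearMap (derivationsMap (h : M' →ₗ[k] M) (g : N →ₗ[k] N') hh hg)
    (derivationsMap (h.symm : M →ₗ[k] M') (g.symm : N' →ₗ[k] N)
      (fun a => by
        ext x
        have := LinearMap.congr_fun (hh a) (h.symm x)
        simp only [LinearMap.comp_apply, LinearEquiv.coe_coe, LinearEquiv.apply_symm_apply] at this
        simp [this])
      (fun a => by
        ext x
        have := LinearMap.congr_fun (hg a) (g.symm x)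
        simp only [LinearMap.comp_apply, LinearEquiv.coe_coe, LinearEquiv.apply_symm_apply] at this
        simp [← this]))
    (by ext; simp) (by ext; simp)

/-- Restriction of derivations along an algebra morphism. -/
def derivationsComp (f : B →ₐ[k] A) :
    derivations r l →ₗ[k] derivations (r.comp f) (l.comp f) where
  toFun D := ⟨D.1 ∘ₗ f.toLinearMap, fun a b => by simp [derivations_apply_mul]⟩
  map_add' D E := by ext; simp
  map_smul' c D := by ext; simp

@[simp]
theorem derivationsComp_apply (f : B →ₐ[k] A) (D : derivations r l) (b : B) :
    (derivationsComp f D).1 b = D.1 (f b) := rfl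

section Free

variable {X : Type*} {r : FreeAlgebra k X →ₐ[k] Module.End k M}
  {l : FreeAlgebra k X →ₐ[k] Module.End k N}

/-- Evaluation of derivations of the free algebra on the generators. -/
def derivationsEval (r : FreeAlgebra k X →ₐ[k] Module.End k M)
    (l : FreeAlgebra k X →ₐ[k] Module.End k N) : derivations r l →ₗ[k] (X → M →ₗ[k] N) where
  toFun D x := D.1 (FreeAlgebra.ι k x)
  map_add' _ _ := rfl
  map_smul' _ _ := rfl

theorem derivationsEval_apply (D : derivations r l) (x : X) :
    derivationsEval r l D x = D.1 (FreeAlgebra.ι k x) := rfl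

theorem derivationsEval_injective : Function.Injective (derivationsEval r l) := by
  rw [injective_iff_map_eq_zero]
  intro D hD
  ext1
  ext1 y
  induction y using FreeAlgebra.induction with
  | grade0 c => simp [Algebra.algebraMap_eq_smul_one, derivations_apply_one]
  | grade1 x => exact congrFun hD x
  | mul a b ha hb => simp [derivations_apply_mul, ha, hb]
  | add a b ha hb => simp [ha, hb]

/-- The block triangular representation attached to the values of a derivation. -/
def blockRep (r : FreeAlgebra k X →ₐ[k] Module.End k M) (l : FreeAlgebra k X →ₐ[k] Module.End k N)
    (e : X → M →ₗ[k] N) : FreeAlgebra k X →ₐ[k] Module.End k (N × M) :=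
  FreeAlgebra.lift k fun x =>
    (LinearMap.coprod (l (FreeAlgebra.ι k x)) (e x)).prod (r (FreeAlgebra.ι k x) ∘ₗ
      LinearMap.snd k N M)

theorem blockRep_inl (e : X → M →ₗ[k] N) (y : FreeAlgebra k X) (n : N) :
    blockRep r l e y (n, 0) = (l y n, 0) := by
  induction y using FreeAlgebra.induction generalizing n with
  | grade0 c => simp [Algebra.algebraMap_eq_smul_one]
  | grade1 x => simp [blockRep]
  | mul a b ha hb => simp [ha, hb]
  | add a b ha hb => simp [ha, hb]

theorem blockRep_snd (e : X → M →ₗ[k] N) (y : FreeAlgebra k X) (z : N × M) :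
    (blockRep r l e y z).2 = r y z.2 := by
  induction y using FreeAlgebra.induction generalizing z with
  | grade0 c => simp [Algebra.algebraMap_eq_smul_one]
  | grade1 x => simp [blockRep]
  | mul a b ha hb => simp [ha, hb]
  | add a b ha hb => simp [ha, hb]

/-- The off-diagonal block of a block triangular representation is a derivation, and on a free
algebra the blocks at the generators can be prescribed. -/
theorem derivationsEval_surjective : Function.Surjective (derivationsEval r l) := by
  intro e
  refine ⟨⟨(LinearMap.lcomp k N (LinearMap.inr k N M) ∘ₗ
    LinearMap.compRight k (LinearMap.fst k N M)) ∘ₗ (blockRep r l e).toLinearMap, fun a b => ?_⟩, ?_⟩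
  · ext m
    -- Splitting the vector into its `N` and `M` parts makes the two diagonal actions produce the
    -- two Leibniz terms.
    have h : blockRep r l e b (0, m) = ((blockRep r l e b (0, m)).1, 0) + (0, r b m) := by
      ext <;> simp [blockRep_snd]
    simp only [AlgHom.toLinearMap_apply, LinearMap.comp_apply, map_mul, LinearMap.lcomp_apply,
      LinearMap.compRight_apply, LinearMap.inr_apply, LinearMap.fst_apply, Module.End.mul_apply,
      LinearMap.add_apply]
    conv_lhs => rw [h, map_add, blockRep_inl]
    simp
  · ext x m
    simp [derivationsEval_apply, blockRep]

/-- Derivations of a free algebra are given by arbitrary values on the generators. -/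
noncomputable def derivationsFreeEquiv (r : FreeAlgebra k X →ₐ[k] Module.End k M)
    (l : FreeAlgebra k X →ₐ[k] Module.End k N) : derivations r l ≃ₗ[k] (X → M →ₗ[k] N) :=
  LinearEquiv.ofBijective (derivationsEval r l)
    ⟨derivationsEval_injective, derivationsEval_surjective⟩

@[simp]
theorem derivationsFreeEquiv_apply (D : derivations r l) (x : X) :
    derivationsFreeEquiv r l D x = D.1 (FreeAlgebra.ι k x) := rfl

@[simp]
theorem derivationsFreeEquiv_symm_ι (e : X → M →ₗ[k] N) (x : X) :
    ((derivationsFreeEquiv r l).symm e).1 (FreeAlgebra.ι k x) = e x := by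
  rw [← derivationsFreeEquiv_apply, LinearEquiv.apply_symm_apply]

end Free

/-- A set-theoretic section of an algebra morphism `π` that is an algebra morphism modulo the square
of the kernel. -/
structure IsSquareSection (π : B →ₐ[k] A) (Y : A → B) : Prop where
  apply_section : ∀ a, π (Y a) = a
  map_add : ∀ a b, Y (a + b) - (Y a + Y b) ∈ RingHom.ker π * RingHom.ker π
  map_smul : ∀ (c : k) a, Y (c • a) - c • Y a ∈ RingHom.ker π * RingHom.ker π
  map_mul : ∀ a b, Y (a * b) - Y a * Y b ∈ RingHom.ker π * RingHom.ker π

/-- Both actions factor through `π`, so each Leibniz term of a product of two kernel elements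
contains a zero action. -/
theorem derivations_apply_eq_zero {π : B →ₐ[k] A} (D : derivations (r.comp π) (l.comp π)) {y : B}
    (hy : y ∈ RingHom.ker π * RingHom.ker π) : D.1 y = 0 := by
  induction hy using Submodule.mul_induction_on' with
  | mem_mul_mem a ha b hb =>
    have ha' : π a = 0 := ha
    have hb' : π b = 0 := hb
    simp [derivations_apply_mul, ha', hb']
  | add a _ b _ ha hb => simp [ha, hb]

/-- The derivation of `A` obtained from a derivation of `B` through a section of `B → A` modulo the
square of the kernel. -/
def derivationsDescend (r : A →ₐ[k] Module.End k M) (l : A →ₐ[k] Module.End k N) {π : B →ₐ[k] A}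
    {Y : A → B} (hY : IsSquareSection π Y) :
    derivations (r.comp π) (l.comp π) →ₗ[k] derivations r l where
  toFun D :=
    have H {x y : B} (h : x - y ∈ RingHom.ker π * RingHom.ker π) : D.1 x = D.1 y := by
      rw [← sub_eq_zero, ← map_sub, derivations_apply_eq_zero D h]
    ⟨{  toFun := fun a => D.1 (Y a)
        map_add' := fun a b => by rw [H (hY.map_add a b), map_add]
        map_smul' := fun c a => by rw [H (hY.map_smul c a), map_smul, RingHom.id_apply] },
      fun a b => by
        change D.1 (Y (a * b)) = l a ∘ₗ D.1 (Y b) + D.1 (Y a) ∘ₗ r b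
        rw [H (hY.map_mul a b), derivations_apply_mul]
        simp [hY.apply_section]⟩
  map_add' _ _ := rfl
  map_smul' _ _ := rfl

@[simp]
theorem derivationsDescend_apply {π : B →ₐ[k] A} {Y : A → B} (hY : IsSquareSection π Y)
    (D : derivations (r.comp π) (l.comp π)) (a : A) :
    (derivationsDescend r l hY D).1 a = D.1 (Y a) := rfl

theorem derivationsDescend_comp {π : B →ₐ[k] A} {Y : A → B} (hY : IsSquareSection π Y)
    (D : derivations r l) : derivationsDescend r l hY (derivationsComp π D) = D := by
  ext a : 2
  simp [hY.apply_section]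

end Derivations

/-! ### Formal smoothness: splitting a free presentation modulo the square of its kernel. -/

section Lift

variable {k : Type u} [Field k] {A : Type v} [Ring A] [Algebra k A]

/-- The lifting property only tests algebras in the universe of `A`. When `A` is nontrivial, `k`
embeds in it, which bounds the size of the free algebra. -/
theorem small_freeAlgebra [Nontrivial A] (X : Type v) : Small.{v} (FreeAlgebra k X) := by
  have : Small.{v} k := small_of_injective (algebraMap k A).injective
  have : Small.{v} (FreeMonoid X →₀ k) :=
    small_of_injective (β := FreeMonoid X → k) DFunLike.coe_injective
  have : Small.{v} (MonoidAlgebra k (FreeMonoid X)) :=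
    small_map MonoidAlgebra.coeffEquiv
  exact small_map (FreeAlgebra.equivMonoidAlgebraFreeMonoid (R := k) (X := X)).toEquiv

/-- This is the lifting property applied to the inverse of `B/ker q ≃ A`, after replacing `B` by a
copy in the right universe; the kernel has square zero. -/
theorem exists_section {B : Type*} [Ring B] [Algebra k B] [Small.{v} B] (hA : IsQurve k A)
    (q : B →ₐ[k] A) (hq : Function.Surjective q)
    (hker : ∀ x y, q x = 0 → q y = 0 → x * y = 0) : ∃ s : A →ₐ[k] B, q.comp s = AlgHom.id k A := by
  let e : Shrink.{v} B ≃ₐ[k] B := Shrink.algEquiv k B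
  let p : Shrink.{v} B →ₐ[k] A := q.comp e
  have hp : Function.Surjective p := hq.comp e.surjective
  let E := Ideal.quotientKerAlgEquivOfSurjective hp
  have hnil : ∀ L : List (Shrink.{v} B), L.length = 2 → (∀ x ∈ L, x ∈ RingHom.ker p) →
      L.prod = 0 := by
    intro L hL hmem
    obtain ⟨x, y, rfl⟩ := List.length_eq_two.1 hL
    have hx : q (e x) = 0 := hmem x (by simp)
    have hy : q (e y) = 0 := hmem y (by simp)
    apply e.injective
    simp [hker _ _ hx hy]
  obtain ⟨g, hg⟩ := hA.lift (Shrink.{v} B) (RingHom.ker p) ⟨2, hnil⟩ E.symm.toAlgHom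
  refine ⟨e.toAlgHom.comp g, ?_⟩
  ext a
  have h := DFunLike.congr_fun hg a
  have h' : E (Ideal.Quotient.mkₐ k (RingHom.ker p) (g a)) = a := by
    change E ((Ideal.Quotient.mkₐ k (RingHom.ker p)).comp g a) = a
    rw [h]
    exact E.apply_symm_apply a
  exact h'

theorem exists_isSquareSection (hA : IsQurve k A) (X : Type v) (π : FreeAlgebra k X →ₐ[k] A)
    (hπ : Function.Surjective π) : ∃ Y, IsSquareSection π Y := by
  cases subsingleton_or_nontrivial A with
  -- The zero algebra is treated apart, since `k` does not embed in it; there any map to the free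
  -- algebra with values in the squared kernel will do.
  | inl h => exact ⟨fun _ => 0, fun _ => Subsingleton.elim _ _, by simp, by simp, by simp⟩
  | inr h =>
    let J := RingHom.ker π * RingHom.ker π
    have hJ : ∀ x ∈ J, π x = 0 := fun x hx => Ideal.mul_le_left (I := RingHom.ker π) hx
    have := small_freeAlgebra (k := k) (A := A) X
    have : Small.{v} (FreeAlgebra k X ⧸ J) :=
      small_of_surjective (Ideal.Quotient.mk_surjective (I := J))
    let q : FreeAlgebra k X ⧸ J →ₐ[k] A := Ideal.Quotient.liftₐ J π hJ
    have hq (y) : q (Ideal.Quotient.mk J y) = π y := rfl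
    obtain ⟨s, hs⟩ := exists_section hA q
      (fun a => (hπ a).imp' (Ideal.Quotient.mk J) fun y hy => hy) (fun x y => by
        obtain ⟨x, rfl⟩ := Ideal.Quotient.mk_surjective x
        obtain ⟨y, rfl⟩ := Ideal.Quotient.mk_surjective y
        intro hx hy
        rw [← map_mul, Ideal.Quotient.eq_zero_iff_mem]
        exact Ideal.mul_mem_mul hx hy)
    choose Y hY using fun a => Ideal.Quotient.mk_surjective (s a)
    refine ⟨Y, fun a => ?_, fun a b => ?_, fun c a => ?_, fun a b => ?_⟩
    · rw [← hq, hY]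
      exact DFunLike.congr_fun hs a
    · rw [← Ideal.Quotient.eq, map_add, hY, hY, hY, map_add]
    · rw [← Ideal.Quotient.eq]
      have : Ideal.Quotient.mk J (c • Y a) = c • Ideal.Quotient.mk J (Y a) := rfl
      rw [this, hY, hY, map_smul]
    · rw [← Ideal.Quotient.eq, map_mul, hY, hY, hY, map_mul]

/-- A presentation of a qurve by a free algebra, with a section modulo the square of the kernel. -/
theorem IsQurve.exists_presentation (hA : IsQurve k A) :
    ∃ (X : Type v) (_ : Fintype X) (π : FreeAlgebra k X →ₐ[k] A) (Y : A → FreeAlgebra k X),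
      IsSquareSection π Y := by
  obtain ⟨X, hX, π, hπ⟩ := Algebra.FiniteType.iff_quotient_freeAlgebra'.1 hA.finiteType
  obtain ⟨Y, hY⟩ := exists_isSquareSection hA X π hπ
  exact ⟨X, hX, π, Y, hY⟩

end Lift

/-! ### The kernel of `A ⊗ M → M` as the universal target of derivations. -/

section Bar

open TensorProduct

variable {k : Type*} [Field k] {A : Type*} [Ring A] [Algebra k A]
  {M N : Type*} [AddCommGroup M] [Module k M] [Module A M] [IsScalarTower k A M]
  [AddCommGroup N] [Module k N] [Module A N] [IsScalarTower k A N]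

/-- The extension of a `k`-linear map `M → N` to an `A`-linear map `A ⊗ M → N`. -/
noncomputable def extendScalars (f : M →ₗ[k] N) : A ⊗[k] M →ₗ[A] N :=
  TensorProduct.AlgebraTensorModule.lift (LinearMap.toSpanSingleton A (M →ₗ[k] N) f)

omit [Module A M] [IsScalarTower k A M] in
@[simp]
theorem extendScalars_tmul (f : M →ₗ[k] N) (a : A) (m : M) :
    extendScalars f (a ⊗ₜ[k] m) = a • f m := rfl

theorem extendScalars_surjective :
    Function.Surjective (extendScalars (A := A) (LinearMap.id : M →ₗ[k] M)) :=
  fun m => ⟨1 ⊗ₜ m, by simp⟩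

variable (k A M) in
/-- The kernel of the action map `A ⊗ M → M`. -/
noncomputable abbrev actionKer : Submodule A (A ⊗[k] M) :=
  LinearMap.ker (extendScalars (LinearMap.id : M →ₗ[k] M))

/-- The projection of `A ⊗ M` onto the kernel of the action map. -/
noncomputable def toActionKer : A ⊗[k] M →ₗ[k] actionKer k A M where
  toFun z := ⟨z - 1 ⊗ₜ extendScalars LinearMap.id z, by simp⟩
  map_add' x y := by
    ext1
    simp only [map_add, tmul_add, Submodule.coe_add]
    abel
  map_smul' c x := by
    ext1
    have : extendScalars (A := A) (LinearMap.id : M →ₗ[k] M) (c • x) =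
        c • extendScalars (A := A) (LinearMap.id : M →ₗ[k] M) x :=
      (extendScalars (A := A) (LinearMap.id : M →ₗ[k] M)).map_smul_of_tower c x
    simp [this, smul_sub]

theorem toActionKer_coe (z : actionKer k A M) : toActionKer (z : A ⊗[k] M) = z := by
  ext1
  have : extendScalars (A := A) (LinearMap.id : M →ₗ[k] M) z = 0 := z.2
  simp [toActionKer, this]

/-- This is the Leibniz rule for the universal derivation, `a ↦ (m ↦ a ⊗ m - 1 ⊗ am)`. -/
theorem toActionKer_mul_tmul (a b : A) (m : M) :
    toActionKer (k := k) ((a * b) ⊗ₜ[k] m) =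
      a • toActionKer (b ⊗ₜ[k] m) + toActionKer (a ⊗ₜ[k] (b • m)) := by
  ext1
  simp [toActionKer, mul_smul, smul_sub, smul_tmul']

/-- By Leibniz, the defect of `A`-linearity is `D a` applied to the image under the action map, so
it vanishes on the kernel of that map. -/
theorem lift_derivation_smul (D : derivations (Algebra.lsmul k k M : A →ₐ[k] Module.End k M)
    (Algebra.lsmul k k N : A →ₐ[k] Module.End k N)) (a : A) (z : A ⊗[k] M) :
    TensorProduct.lift D.1 (a • z) =
      a • TensorProduct.lift D.1 z + D.1 a (extendScalars LinearMap.id z) := by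
  induction z using TensorProduct.induction_on with
  | zero => simp
  | tmul b m => simp [smul_tmul', derivations_apply_mul]
  | add x y hx hy =>
    simp only [smul_add, map_add, hx, hy]
    abel

/-- Derivations with values in `Hom_k(M, N)` are the homomorphisms to `N` from the kernel of the
action map `A ⊗ M → M`. -/
noncomputable def derivationsEquiv : derivations (Algebra.lsmul k k M : A →ₐ[k] Module.End k M)
    (Algebra.lsmul k k N : A →ₐ[k] Module.End k N) ≃ₗ[k] (actionKer k A M →ₗ[A] N) where
  toFun D :=
    { toFun := fun z => TensorProduct.lift D.1 (z : A ⊗[k] M)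
      map_add' := fun x y => by simp
      map_smul' := fun a z => by
        have : extendScalars (A := A) (LinearMap.id : M →ₗ[k] M) z = 0 := z.2
        simp [lift_derivation_smul, this] }
  map_add' D E := by
    ext z
    exact LinearMap.congr_fun ((TensorProduct.uncurry (.id k) A M N).map_add D.1 E.1) _
  map_smul' c D := by
    ext z
    exact LinearMap.congr_fun ((TensorProduct.uncurry (.id k) A M N).map_smul c D.1) _
  invFun f := ⟨TensorProduct.curry (f.restrictScalars k ∘ₗ toActionKer), fun a b => by
    ext m
    simp [toActionKer_mul_tmul]⟩
  left_inv D := by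
    ext a m
    simp [toActionKer, derivations_apply_one]
  right_inv f := by
    ext z
    change TensorProduct.lift (TensorProduct.curry (f.restrictScalars k ∘ₗ toActionKer)) _ = _
    rw [show TensorProduct.lift (TensorProduct.curry (f.restrictScalars k ∘ₗ toActionKer)) =
      f.restrictScalars k ∘ₗ toActionKer by ext; rfl]
    simp [toActionKer_coe]

theorem derivationsEquiv_apply (D : derivations (Algebra.lsmul k k M : A →ₐ[k] Module.End k M)
    (Algebra.lsmul k k N : A →ₐ[k] Module.End k N)) (z : actionKer k A M) :
    derivationsEquiv D z = TensorProduct.lift D.1 (z : A ⊗[k] M) := rfl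

variable (k A M N) in
/-- The inner derivation attached to a `k`-linear map. -/
def innerDerivation : (M →ₗ[k] N) →ₗ[k] derivations (Algebra.lsmul k k M : A →ₐ[k] Module.End k M)
    (Algebra.lsmul k k N : A →ₐ[k] Module.End k N) where
  toFun f := ⟨LinearMap.lcomp k N f ∘ₗ (Algebra.lsmul k k N).toLinearMap -
    LinearMap.compRight k f ∘ₗ (Algebra.lsmul k k M).toLinearMap, fun a b => by
      ext m
      simp [smul_sub]⟩
  map_add' f g := by
    ext a m
    simp
    abel
  map_smul' c f := by
    ext a m
    simp [smul_sub]

@[simp]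
theorem innerDerivation_apply (f : M →ₗ[k] N) (a : A) (m : M) :
    (innerDerivation k A M N f).1 a m = a • f m - f (a • m) := rfl

theorem derivationsEquiv_innerDerivation (f : M →ₗ[k] N) :
    derivationsEquiv (innerDerivation k A M N f) = extendScalars f ∘ₗ (actionKer k A M).subtype := by
  have H (z : A ⊗[k] M) : TensorProduct.lift (innerDerivation k A M N f).1 z =
      extendScalars f z - f (extendScalars (A := A) LinearMap.id z) := by
    induction z using TensorProduct.induction_on with
    | zero => simp
    | tmul b m => simp
    | add x y hx hy =>
      simp only [map_add, hx, hy]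
      abel
  ext z
  have : extendScalars (A := A) (LinearMap.id : M →ₗ[k] M) z = 0 := z.2
  simp [derivationsEquiv_apply, H, this]

omit [Module A M] [IsScalarTower k A M] in
theorem exists_extendScalars (g : A ⊗[k] M →ₗ[A] N) : ∃ f : M →ₗ[k] N, extendScalars f = g := by
  refine ⟨g.restrictScalars k ∘ₗ TensorProduct.mk k A M 1, ?_⟩
  ext m
  simp

variable (k A M N) in
/-- The module homomorphisms are the linear maps whose inner derivation vanishes. -/
noncomputable def homEquivKerInnerDerivation :
    (M →ₗ[A] N) ≃ₗ[k] LinearMap.ker (innerDerivation k A M N) where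
  toFun f := ⟨f.restrictScalars k, by
    rw [LinearMap.mem_ker]
    ext a m
    simp⟩
  map_add' f g := rfl
  map_smul' c f := rfl
  invFun f :=
    { toFun := f.1
      map_add' := map_add f.1
      map_smul' := fun a m => by
        have h : innerDerivation k A M N f.1 = 0 := f.2
        have := congrArg (fun D => D.1 a m) h
        exact (sub_eq_zero.1 this).symm }
  left_inv f := rfl
  right_inv f := rfl

end Bar

/-! ### `Ext¹` as derivations modulo inner derivations, and the formula for the Euler form. -/

section Ext

variable {k : Type u} [Field k] {A : Type v} [Ring A] [Algebra k A]

/-- The derivations with values in `Hom_k(M, N)`. -/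
abbrev moduleDerivations (k : Type u) [Field k] {A : Type v} [Ring A] [Algebra k A]
    (M N : ModuleCat.{v} A) : Submodule k (A →ₗ[k] M →ₗ[k] N) :=
  derivations (Algebra.lsmul k k M : A →ₐ[k] Module.End k M)
    (Algebra.lsmul k k N : A →ₐ[k] Module.End k N)

open TensorProduct

variable (k) in
/-- The standard presentation of a module by a projective module. -/
noncomputable def barComplex (M : ModuleCat.{v} A) : ShortComplex (ModuleCat.{v} A) :=
  ShortComplex.mk (ModuleCat.ofHom (X := actionKer k A M) (Y := A ⊗[k] M) (actionKer k A M).subtype)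
    (ModuleCat.ofHom (X := A ⊗[k] M) (Y := M) (extendScalars (A := A) (LinearMap.id : M →ₗ[k] M))) (by
      ext z
      exact z.2)

theorem barComplex_shortExact (M : ModuleCat.{v} A) : (barComplex k M).ShortExact := by
  have : Mono (barComplex k M).f :=
    (ModuleCat.mono_iff_injective _).2 (actionKer k A M).injective_subtype
  have : Epi (barComplex k M).g :=
    (ModuleCat.epi_iff_surjective _).2 (extendScalars_surjective (k := k) (M := M))
  refine ⟨?_⟩
  rw [ShortComplex.moduleCat_exact_iff]
  exact fun z hz => ⟨⟨z, hz⟩, rfl⟩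

/-- `M` is free over the field `k`, hence `A ⊗ M` is free over `A`. -/
instance (M : ModuleCat.{v} A) : Projective (barComplex k M).X₂ :=
  ModuleCat.projective_of_categoryTheory_projective (P := ModuleCat.of A (A ⊗[k] M))

/-- Derivations as morphisms out of the kernel in the standard presentation. -/
noncomputable def barHomEquiv (M N : ModuleCat.{v} A) :
    moduleDerivations k M N ≃ₗ[k] ((barComplex k M).X₁ ⟶ N) :=
  derivationsEquiv.trans
    (ModuleCat.homLinearEquiv (M := ModuleCat.of A (actionKer k A M)) (N := N) (S := k)).symm

theorem barHomEquiv_innerDerivation {M N : ModuleCat.{v} A} (f : M →ₗ[k] N) :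
    barHomEquiv M N (innerDerivation k A M N f) =
      (barComplex k M).f ≫ ModuleCat.ofHom (X := A ⊗[k] M) (Y := N) (extendScalars f) := by
  apply ModuleCat.hom_ext
  change derivationsEquiv (innerDerivation k A M N f) = _
  rw [derivationsEquiv_innerDerivation]
  rfl

theorem exists_innerDerivation {M N : ModuleCat.{v} A} (g : (barComplex k M).X₂ ⟶ N) :
    ∃ f : M →ₗ[k] N, barHomEquiv M N (innerDerivation k A M N f) = (barComplex k M).f ≫ g := by
  obtain ⟨f, hf⟩ := exists_extendScalars (k := k) (A := A) (M := M) (N := N) g.hom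
  refine ⟨f, ?_⟩
  rw [barHomEquiv_innerDerivation, hf]
  rfl

/-- The extension class attached to a derivation. -/
noncomputable def derivationsToExt (M N : ModuleCat.{v} A) :
    moduleDerivations k M N →ₗ[k] Abelian.Ext M N 1 where
  toFun D := (barComplex_shortExact (k := k) M).extClass.comp
      (Abelian.Ext.mk₀ (barHomEquiv M N D)) (add_zero 1)
  map_add' D E := by rw [map_add, Abelian.Ext.mk₀_add, Abelian.Ext.comp_add]; rfl
  map_smul' c D := by
    rw [RingHom.id_apply, map_smul, Abelian.Ext.mk₀_smul, Abelian.Ext.comp_smul]; rfl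

theorem derivationsToExt_apply {M N : ModuleCat.{v} A} (D : moduleDerivations k M N) :
    derivationsToExt M N D = (barComplex_shortExact (k := k) M).extClass.comp
      (Abelian.Ext.mk₀ (barHomEquiv M N D)) (add_zero 1) := rfl

/-- In the long exact sequence the next term, `Ext¹(A ⊗ M, N)`, vanishes by projectivity. -/
theorem derivationsToExt_surjective (M N : ModuleCat.{v} A) :
    Function.Surjective (derivationsToExt (k := k) M N) := by
  intro x
  obtain ⟨y, rfl⟩ := Abelian.Ext.contravariant_sequence_exact₃ (barComplex_shortExact (k := k) M)
    N x (Abelian.Ext.eq_zero_of_projective _) (add_zero 1)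
  refine ⟨(barHomEquiv M N).symm (Abelian.Ext.addEquiv₀ y), ?_⟩
  rw [derivationsToExt_apply, LinearEquiv.apply_symm_apply, Abelian.Ext.mk₀_addEquiv₀_apply]

/-- By exactness, a class vanishes when its map on the kernel extends to `A ⊗ M`. Maps `A ⊗ M → N`
come from `k`-linear maps `M → N`, and their restrictions correspond to inner derivations. -/
theorem ker_derivationsToExt (M N : ModuleCat.{v} A) :
    LinearMap.ker (derivationsToExt (k := k) M N) = LinearMap.range (innerDerivation k A M N) := by
  ext D
  rw [LinearMap.mem_ker, LinearMap.mem_range]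
  constructor
  · intro h
    obtain ⟨y, hy⟩ := Abelian.Ext.contravariant_sequence_exact₁ (barComplex_shortExact (k := k) M) N
      _ (add_zero 1) h
    obtain ⟨f, hf⟩ := exists_innerDerivation (k := k) (Abelian.Ext.addEquiv₀ y)
    refine ⟨f, (barHomEquiv M N).injective ?_⟩
    rw [hf]
    apply Abelian.Ext.homEquiv₀.symm.injective
    change Abelian.Ext.mk₀ _ = Abelian.Ext.mk₀ _
    rw [← Abelian.Ext.mk₀_comp_mk₀, Abelian.Ext.mk₀_addEquiv₀_apply, hy]
  · rintro ⟨f, rfl⟩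
    obtain ⟨g, hg⟩ : ∃ g : (barComplex k M).X₂ ⟶ N,
        barHomEquiv M N (innerDerivation k A M N f) = (barComplex k M).f ≫ g :=
      ⟨_, barHomEquiv_innerDerivation f⟩
    rw [derivationsToExt_apply, hg, ← Abelian.Ext.mk₀_comp_mk₀,
      ← Abelian.Ext.comp_assoc_of_second_deg_zero, ShortComplex.ShortExact.extClass_comp,
      Abelian.Ext.zero_comp]
    rfl

theorem finite_hom (M N : ModuleCat.{v} A) [Module.Finite k M] [Module.Finite k N] :
    Module.Finite k (M ⟶ N) :=
  Module.Finite.equiv (((ModuleCat.homLinearEquiv (S := k)).trans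
    (homEquivKerInnerDerivation k A M N)).symm)

theorem finite_ext (M N : ModuleCat.{v} A) [Module.Finite k (moduleDerivations k M N)] :
    Module.Finite k (Abelian.Ext M N 1) :=
  Module.Finite.of_surjective _ (derivationsToExt_surjective M N)

/-- The Euler form in terms of derivations. -/
theorem eulerForm_eq (M N : ModuleCat.{v} A) [Module.Finite k M] [Module.Finite k N]
    [Module.Finite k (moduleDerivations k M N)] :
    eulerForm k M N = (Module.finrank k M : ℤ) * Module.finrank k N -
      Module.finrank k (moduleDerivations k M N) := by
  -- Rank–nullity twice: for `Der → Ext¹`, whose kernel is the inner derivations, and for `Hom_k →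
  -- Der`, whose kernel is `Hom_A`.
  have h1 := LinearMap.finrank_range_add_finrank_ker (V := moduleDerivations k M N)
    (derivationsToExt (k := k) M N)
  rw [LinearMap.range_eq_top.2 (derivationsToExt_surjective M N), finrank_top,
    ker_derivationsToExt] at h1
  have h2 := LinearMap.finrank_range_add_finrank_ker (V := M →ₗ[k] N)
    (V₂ := moduleDerivations k M N) (innerDerivation k A M N)
  rw [Module.finrank_linearMap] at h2
  have h3 := (((ModuleCat.homLinearEquiv (S := k)).trans
    (homEquivKerInnerDerivation k A M N))).finrank_eq
  rw [eulerForm, h3]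
  zify at h1 h2
  linarith

end Ext

/-! ### Derivations of `A` as the image of an idempotent on `Hom_k(M, N)^X`. -/

section Projection

variable {k : Type*} [Field k] {A : Type*} [Ring A] [Algebra k A] {X : Type*}
  {π : FreeAlgebra k X →ₐ[k] A} {Y : A → FreeAlgebra k X}
  {M M' N N' : Type*} [AddCommGroup M] [Module k M] [AddCommGroup M'] [Module k M']
  [AddCommGroup N] [Module k N] [AddCommGroup N'] [Module k N']
  {r : A →ₐ[k] Module.End k M} {l : A →ₐ[k] Module.End k N}
  {r' : A →ₐ[k] Module.End k M'} {l' : A →ₐ[k] Module.End k N'}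

/-- The values of a derivation on the generators. -/
noncomputable def derivationsValues (r : A →ₐ[k] Module.End k M) (l : A →ₐ[k] Module.End k N)
    (π : FreeAlgebra k X →ₐ[k] A) : derivations r l →ₗ[k] (X → M →ₗ[k] N) :=
  (derivationsFreeEquiv (r.comp π) (l.comp π)).toLinearMap ∘ₗ derivationsComp π

/-- The derivation of `A` obtained from arbitrary values on the generators. -/
noncomputable def derivationsOfValues (r : A →ₐ[k] Module.End k M) (l : A →ₐ[k] Module.End k N)
    (hY : IsSquareSection π Y) : (X → M →ₗ[k] N) →ₗ[k] derivations r l :=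
  derivationsDescend r l hY ∘ₗ (derivationsFreeEquiv (r.comp π) (l.comp π)).symm.toLinearMap

theorem derivationsOfValues_values (hY : IsSquareSection π Y) (D : derivations r l) :
    derivationsOfValues r l hY (derivationsValues r l π D) = D := by
  simp [derivationsOfValues, derivationsValues, derivationsDescend_comp]

theorem derivationsValues_injective (hY : IsSquareSection π Y) :
    Function.Injective (derivationsValues r l π) :=
  Function.LeftInverse.injective (derivationsOfValues_values hY)

theorem derivationsOfValues_surjective (hY : IsSquareSection π Y) :
    Function.Surjective (derivationsOfValues r l hY) :=
  Function.RightInverse.surjective (derivationsOfValues_values hY)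

theorem finite_derivations [Finite X] [Module.Finite k M] [Module.Finite k N]
    (hY : IsSquareSection π Y) : Module.Finite k (derivations r l) :=
  Module.Finite.of_surjective _ (derivationsOfValues_surjective (r := r) (l := l) hY)

/-- The idempotent whose image is the space of derivations. -/
noncomputable def derivationsProj (r : A →ₐ[k] Module.End k M) (l : A →ₐ[k] Module.End k N)
    (hY : IsSquareSection π Y) : Module.End k (X → M →ₗ[k] N) :=
  derivationsValues r l π ∘ₗ derivationsOfValues r l hY

theorem isIdempotentElem_derivationsProj (hY : IsSquareSection π Y) :
    IsIdempotentElem (derivationsProj r l hY) := by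
  refine LinearMap.ext fun e => ?_
  simp [derivationsProj, derivationsOfValues_values]

theorem finrank_range_derivationsProj (hY : IsSquareSection π Y) :
    Module.finrank k (LinearMap.range (derivationsProj r l hY)) =
      Module.finrank k (derivations r l) := by
  rw [derivationsProj, LinearMap.range_comp_of_range_eq_top _
    (LinearMap.range_eq_top.2 (derivationsOfValues_surjective hY))]
  exact LinearMap.finrank_range_of_inj (derivationsValues_injective hY)

/-- It suffices to lift the values on the generators one by one as linear maps: they define a
derivation of the free algebra, which descends to `A` along the section `Y`. No `A`-linear splitting
is needed. -/
theorem derivationsMap_surjective (hY : IsSquareSection π Y) (h : M' →ₗ[k] M) (g : N →ₗ[k] N')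
    (hh : ∀ a, r a ∘ₗ h = h ∘ₗ r' a) (hg : ∀ a, g ∘ₗ l a = l' a ∘ₗ g)
    (hs : ∀ f' : M' →ₗ[k] N', ∃ f : M →ₗ[k] N, g ∘ₗ f ∘ₗ h = f') :
    Function.Surjective (derivationsMap h g hh hg) := by
  intro D'
  choose e he using fun x => hs (D'.1 (π (FreeAlgebra.ι k x)))
  let E := (derivationsFreeEquiv (r.comp π) (l.comp π)).symm e
  have hE : derivationsMap h g (fun a => hh (π a)) (fun a => hg (π a)) E =
      derivationsComp π D' := by
    apply derivationsEval_injective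
    ext x m
    change g (E.1 (FreeAlgebra.ι k x) (h m)) = D'.1 (π (FreeAlgebra.ι k x)) m
    rw [derivationsFreeEquiv_symm_ι, ← he]
    rfl
  refine ⟨derivationsDescend r l hY E, ?_⟩
  ext a m
  have h1 : g (E.1 (Y a) (h m)) = D'.1 (π (Y a)) m := congrArg (fun D => D.1 (Y a) m) hE
  rw [hY.apply_section] at h1
  exact h1

end Projection

/-! ### Exactness of derivations in each argument. -/

section Additivity

variable {k : Type*} [Field k] {A : Type*} [Ring A] [Algebra k A] {X : Type*} [Finite X]
  {π : FreeAlgebra k X →ₐ[k] A} {Y : A → FreeAlgebra k X}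
  {M₁ M M₂ N₁ N N₂ : Type*} [AddCommGroup M₁] [Module k M₁] [AddCommGroup M] [Module k M]
  [AddCommGroup M₂] [Module k M₂] [AddCommGroup N₁] [Module k N₁]
  [AddCommGroup N] [Module k N] [AddCommGroup N₂] [Module k N₂]
  {r₁ : A →ₐ[k] Module.End k M₁} {r : A →ₐ[k] Module.End k M} {r₂ : A →ₐ[k] Module.End k M₂}
  {l₁ : A →ₐ[k] Module.End k N₁} {l : A →ₐ[k] Module.End k N} {l₂ : A →ₐ[k] Module.End k N₂}

omit [Finite X] in
theorem finrank_eq_add_of_exact {V₁ V V₂ : Type*} [AddCommGroup V₁] [Module k V₁] [AddCommGroup V]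
    [Module k V] [AddCommGroup V₂] [Module k V₂] [Module.Finite k V] {i : V₁ →ₗ[k] V}
    {p : V →ₗ[k] V₂} (hi : Function.Injective i) (hex : Function.Exact i p)
    (hp : Function.Surjective p) :
    Module.finrank k V = Module.finrank k V₁ + Module.finrank k V₂ := by
  rw [← LinearMap.finrank_range_add_finrank_ker p, LinearMap.exact_iff.1 hex,
    LinearMap.finrank_range_of_inj hi, LinearMap.range_eq_top.2 hp, finrank_top, add_comm]

/-- Formal smoothness makes the space of derivations additive in the target. -/
theorem finrank_derivations_right [Module.Finite k M] [Module.Finite k N]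
    (hY : IsSquareSection π Y) {i : N₁ →ₗ[k] N} {p : N →ₗ[k] N₂}
    (hil : ∀ a, i ∘ₗ l₁ a = l a ∘ₗ i) (hpl : ∀ a, p ∘ₗ l a = l₂ a ∘ₗ p)
    (hi : Function.Injective i) (hex : Function.Exact i p) (hp : Function.Surjective p) :
    Module.finrank k (derivations r l) =
      Module.finrank k (derivations r l₁) + Module.finrank k (derivations r l₂) := by
  have := finite_derivations (r := r) (l := l) hY
  have hid : ∀ a, r a ∘ₗ LinearMap.id = LinearMap.id ∘ₗ r a := fun a => rfl
  refine finrank_eq_add_of_exact (V₁ := derivations r l₁) (V := derivations r l)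
    (V₂ := derivations r l₂) (i := derivationsMap LinearMap.id i hid hil)
    (p := derivationsMap LinearMap.id p hid hpl) ?_ ?_ ?_
  · intro D E h
    ext a m
    exact hi (congrArg (fun D => D.1 a m) h)
  · intro D
    constructor
    · intro hD
      obtain ⟨t, ht⟩ := i.exists_leftInverse_of_injective (LinearMap.ker_eq_bot.2 hi)
      -- The values of `D` lie in the image of `i`, so the retraction `t`, though only `k`-linear,
      -- corestricts `D` to a derivation.
      have hit (a m) : i (t (D.1 a m)) = D.1 a m := by
        obtain ⟨n, hn⟩ := (hex (D.1 a m)).1 (congrArg (fun D => D.1 a m) hD)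
        rw [← hn]
        exact congrArg i (LinearMap.congr_fun ht n)
      refine ⟨⟨LinearMap.compRight k t ∘ₗ D.1, fun a b => ?_⟩, ?_⟩
      · ext m
        apply hi
        have h (n) : i (l₁ a n) = l a (i n) := LinearMap.congr_fun (hil a) n
        change i (t (D.1 (a * b) m)) = i (l₁ a (t (D.1 b m)) + t (D.1 a (r b m)))
        rw [hit, map_add, h, hit, hit, derivations_apply_mul]
        rfl
      · ext a m
        simp [hit]
    · rintro ⟨D, rfl⟩
      ext a m
      simp [hex.apply_apply_eq_zero]
  · refine derivationsMap_surjective hY _ _ _ _ fun f' => ?_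
    obtain ⟨s, hs⟩ := p.exists_rightInverse_of_surjective (LinearMap.range_eq_top.2 hp)
    exact ⟨s ∘ₗ f', by rw [LinearMap.comp_id, ← LinearMap.comp_assoc, hs, LinearMap.id_comp]⟩

/-- Formal smoothness makes the space of derivations additive in the source. -/
theorem finrank_derivations_left [Module.Finite k M] [Module.Finite k N]
    (hY : IsSquareSection π Y) {i : M₁ →ₗ[k] M} {p : M →ₗ[k] M₂}
    (hir : ∀ a, r a ∘ₗ i = i ∘ₗ r₁ a) (hpr : ∀ a, r₂ a ∘ₗ p = p ∘ₗ r a)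
    (hi : Function.Injective i) (hex : Function.Exact i p) (hp : Function.Surjective p) :
    Module.finrank k (derivations r l) =
      Module.finrank k (derivations r₁ l) + Module.finrank k (derivations r₂ l) := by
  have := finite_derivations (r := r) (l := l) hY
  have hid : ∀ a, LinearMap.id ∘ₗ l a = l a ∘ₗ LinearMap.id := fun a => rfl
  rw [add_comm]
  refine finrank_eq_add_of_exact (V₁ := derivations r₂ l) (V := derivations r l)
    (V₂ := derivations r₁ l) (i := derivationsMap p LinearMap.id hpr hid)
    (p := derivationsMap i LinearMap.id hir hid) ?_ ?_ ?_
  · intro D E h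
    ext a m
    obtain ⟨m, rfl⟩ := hp m
    exact congrArg (fun D => D.1 a m) h
  · intro D
    constructor
    · intro hD
      obtain ⟨s, hs⟩ := p.exists_rightInverse_of_surjective (LinearMap.range_eq_top.2 hp)
      -- `D` kills the image of `i`, so precomposing with the `k`-linear section `s` gives a
      -- factorization through `p`.
      have hsp (a m) : D.1 a (s (p m)) = D.1 a m := by
        obtain ⟨n, hn⟩ := (hex (s (p m) - m)).1 (by
          rw [map_sub, sub_eq_zero]
          exact LinearMap.congr_fun hs (p m))
        rw [← sub_eq_zero, ← map_sub, ← hn]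
        exact congrArg (fun D => D.1 a n) hD
      refine ⟨⟨LinearMap.lcomp k N s ∘ₗ D.1, fun a b => ?_⟩, ?_⟩
      · ext m
        obtain ⟨m, rfl⟩ := hp m
        have h (n) : r₂ b (p n) = p (r b n) := LinearMap.congr_fun (hpr b) n
        change D.1 (a * b) (s (p m)) = l a (D.1 b (s (p m))) + D.1 a (s (r₂ b (p m)))
        rw [hsp, hsp, h, hsp, derivations_apply_mul]
        rfl
      · ext a m
        simp [hsp]
    · rintro ⟨D, rfl⟩
      ext a m
      simp [hex.apply_apply_eq_zero]
  · refine derivationsMap_surjective hY _ _ _ _ fun f' => ?_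
    obtain ⟨t, ht⟩ := i.exists_leftInverse_of_injective (LinearMap.ker_eq_bot.2 hi)
    exact ⟨f' ∘ₗ t, by rw [LinearMap.id_comp, LinearMap.comp_assoc, ht, LinearMap.comp_id]⟩

end Additivity

/-! ### Ranks of idempotents in algebraic families. -/

section LocallyConstant

variable {k : Type*} [Field k] {A : Type*} [Ring A] [Algebra k A]

theorem mul_self_add_one_sub_mul_one_sub {V : Type*} [AddCommGroup V] [Module k V]
    {p : Module.End k V} (hp : IsIdempotentElem p) : p * p + (1 - p) * (1 - p) = 1 := by
  rw [hp.eq, hp.one_sub.eq, add_sub_cancel]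

/-- Idempotents that are close to each other have the same rank. -/
theorem finrank_range_eq_of_isIdempotentElem {V : Type*} [AddCommGroup V] [Module k V]
    [Module.Finite k V] {P Q : Module.End k V} (hP : IsIdempotentElem P) (hQ : IsIdempotentElem Q)
    (h : LinearMap.det (P * Q + (1 - P) * (1 - Q)) ≠ 0) :
    Module.finrank k (LinearMap.range P) = Module.finrank k (LinearMap.range Q) := by
  set U := P * Q + (1 - P) * (1 - Q) with hU
  -- Both sides equal `P * Q`; so `U`, once invertible, carries the range of `Q` onto that of `P`.
  have hPU : P * U = U * Q := by
    have e1 : P * U = P * P * Q + (P - P * P) * (1 - Q) := by rw [hU]; noncomm_ring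
    have e2 : U * Q = P * (Q * Q) + (1 - P) * (Q - Q * Q) := by rw [hU]; noncomm_ring
    rw [e1, e2, hP.eq, hQ.eq]
    simp
  let e := LinearMap.equivOfDetNeZero U h
  have he : (e : V →ₗ[k] V) = U := rfl
  have h1 : LinearMap.range P = LinearMap.range (P ∘ₗ (e : V →ₗ[k] V)) :=
    (LinearMap.range_comp_of_range_eq_top _ e.range).symm
  have h2 : P ∘ₗ (e : V →ₗ[k] V) = (e : V →ₗ[k] V) ∘ₗ Q := hPU
  rw [h1, h2, LinearMap.range_comp]
  exact LinearEquiv.finrank_map_eq e _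

variable {T : Type*} (R : Subalgebra k (T → k)) {n m p : ℕ}

/-- A family of linear maps whose matrix coefficients belong to an algebra of functions. -/
def HasCoeffIn (f : T → (Fin n → k) →ₗ[k] (Fin m → k)) : Prop :=
  ∀ i j, (fun t => LinearMap.toMatrix' (f t) i j) ∈ R

variable {R}

theorem HasCoeffIn.const (f : (Fin n → k) →ₗ[k] (Fin m → k)) : HasCoeffIn R fun _ => f :=
  fun i j => R.algebraMap_mem (LinearMap.toMatrix' f i j)

theorem HasCoeffIn.add {f g : T → (Fin n → k) →ₗ[k] (Fin m → k)} (hf : HasCoeffIn R f)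
    (hg : HasCoeffIn R g) : HasCoeffIn R fun t => f t + g t := fun i j => by
  simp only [map_add, Matrix.add_apply]
  exact R.add_mem (hf i j) (hg i j)

theorem HasCoeffIn.comp {f : T → (Fin m → k) →ₗ[k] (Fin p → k)}
    {g : T → (Fin n → k) →ₗ[k] (Fin m → k)} (hf : HasCoeffIn R f)
    (hg : HasCoeffIn R g) : HasCoeffIn R fun t => f t ∘ₗ g t := fun i j => by
  simp only [LinearMap.toMatrix'_comp, Matrix.mul_apply]
  have := R.sum_mem (t := Finset.univ) fun x _ => R.mul_mem (hf i x) (hg x j)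
  convert this using 1
  ext t
  simp

variable {X : Type*} {π : FreeAlgebra k X →ₐ[k] A} {Y : A → FreeAlgebra k X}
  {r : T → A →ₐ[k] Module.End k (Fin n → k)} {l : T → A →ₐ[k] Module.End k (Fin m → k)}

/-- For fixed values on the generators, the Leibniz rule computes the value at `y` by sums and
products of matrices of the two actions, so its coefficients stay in `R`. -/
theorem hasCoeffIn_derivationsFreeEquiv_symm (hr : ∀ a, HasCoeffIn R fun t => r t a)
    (hl : ∀ a, HasCoeffIn R fun t => l t a) (e : X → (Fin n → k) →ₗ[k] (Fin m → k))
    (y : FreeAlgebra k X) : HasCoeffIn R fun t =>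
      ((derivationsFreeEquiv ((r t).comp π) ((l t).comp π)).symm e).1 y := by
  induction y using FreeAlgebra.induction with
  | grade0 c =>
    simp only [Algebra.algebraMap_eq_smul_one, map_smul, derivations_apply_one, smul_zero]
    exact HasCoeffIn.const 0
  | grade1 x =>
    simp only [derivationsFreeEquiv_symm_ι]
    exact HasCoeffIn.const _
  | mul a b ha hb =>
    simp only [derivations_apply_mul]
    exact ((hl (π a)).comp hb).add (ha.comp (hr (π b)))
  | add a b ha hb =>
    simp only [map_add]
    exact ha.add hb

theorem apply_mem_of_hasCoeffIn [Fintype X] {f : T → X → (Fin n → k) →ₗ[k] (Fin m → k)}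
    (hf : ∀ x, HasCoeffIn R fun t => f t x) (φ : (X → (Fin n → k) →ₗ[k] (Fin m → k)) →ₗ[k] k) :
    (fun t => φ (f t)) ∈ R := by
  classical
  have key (v : X → (Fin n → k) →ₗ[k] (Fin m → k)) : φ v = ∑ x, ∑ i, ∑ j,
      LinearMap.toMatrix' (v x) i j * φ (Pi.single x (Matrix.toLin' (Matrix.single i j 1))) := by
    have hv (x) : v x = ∑ i, ∑ j, LinearMap.toMatrix' (v x) i j •
        Matrix.toLin' (Matrix.single i j 1) := by
      apply LinearMap.toMatrix'.injective
      simp only [map_sum, map_smul, LinearMap.toMatrix'_toLin', Matrix.smul_single, smul_eq_mul,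
        mul_one]
      exact Matrix.matrix_eq_sum_single _
    conv_lhs => rw [← Finset.univ_sum_single v, map_sum]
    refine Finset.sum_congr rfl fun x _ => ?_
    conv_lhs => rw [hv x]
    have : ∀ w, φ (Pi.single x w) = (φ ∘ₗ LinearMap.single k _ x) w := fun w => rfl
    simp only [this, map_sum, map_smul, smul_eq_mul]
  have : (fun t => φ (f t)) = ∑ x, ∑ i, ∑ j, (fun t => LinearMap.toMatrix' (f t x) i j) *
      algebraMap k (T → k) (φ (Pi.single x (Matrix.toLin' (Matrix.single i j 1)))) := by
    ext t
    simp [key (f t)]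
  rw [this]
  exact R.sum_mem fun x _ => R.sum_mem fun i _ => R.sum_mem fun j _ =>
    R.mul_mem (hf x i j) (R.algebraMap_mem _)

theorem det_mem {ι : Type*} [Fintype ι] [DecidableEq ι] {W : T → Matrix ι ι k}
    (h : ∀ i j, (fun t => W t i j) ∈ R) : (fun t => (W t).det) ∈ R := by
  have : (fun t => (W t).det) = ∑ σ : Equiv.Perm ι, algebraMap k (T → k) (Equiv.Perm.sign σ : ℤ) *
      ∏ i, (fun t => W t (σ i) i) := by
    ext t
    simp [Matrix.det_apply']
  rw [this]
  exact R.sum_mem fun σ _ => R.mul_mem (R.algebraMap_mem _) (R.prod_mem fun i _ => h _ _)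

/-- The dimension of the space of derivations is locally constant in families. -/
theorem isLocallyConstant_finrank_derivations [Fintype X] [TopologicalSpace T]
    (hR : ∀ f ∈ R, IsOpen {t | f t ≠ 0}) (hY : IsSquareSection π Y)
    (hr : ∀ a, HasCoeffIn R fun t => r t a) (hl : ∀ a, HasCoeffIn R fun t => l t a) :
    IsLocallyConstant fun t => Module.finrank k (derivations (r t) (l t)) := by
  classical
  rw [IsLocallyConstant.iff_exists_open]
  intro t₀
  let V := X → (Fin n → k) →ₗ[k] (Fin m → k)
  let P (t : T) : Module.End k V := derivationsProj (r t) (l t) hY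
  let U (t : T) : Module.End k V := P t * P t₀ + (1 - P t) * (1 - P t₀)
  have hP (t) : IsIdempotentElem (P t) := isIdempotentElem_derivationsProj hY
  -- `P t v` at a generator `x` is the value, at `Y (π x)`, of the free derivation given by `v`.
  -- Neither `Y` nor `π` depends on `t`.
  have hPR (φ : V →ₗ[k] k) (v : V) : (fun t => φ (P t v)) ∈ R :=
    apply_mem_of_hasCoeffIn (fun x => hasCoeffIn_derivationsFreeEquiv_symm hr hl v _) φ
  have hdet : (fun t => LinearMap.det (U t)) ∈ R := by
    let b := Module.finBasis k V
    have : (fun t => LinearMap.det (U t)) = fun t => (LinearMap.toMatrix b b (U t)).det := by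
      ext t
      rw [LinearMap.det_toMatrix]
    rw [this]
    refine det_mem fun i j => ?_
    have : (fun t => LinearMap.toMatrix b b (U t) i j) = (fun t => b.coord i (P t (P t₀ (b j)))) +
        (algebraMap k (T → k) (b.coord i (b j - P t₀ (b j))) -
          fun t => b.coord i (P t (b j - P t₀ (b j)))) := by
      ext t
      simp [LinearMap.toMatrix_apply, U]
    rw [this]
    exact R.add_mem (hPR _ _) (R.sub_mem (R.algebraMap_mem _) (hPR _ _))
  -- The neighbourhood is the locus where `det (U t)` is nonzero; it contains `t₀` because `U t₀ =
  -- 1`.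
  refine ⟨_, hR _ hdet, ?_, fun t ht => ?_⟩
  · have : U t₀ = 1 := mul_self_add_one_sub_mul_one_sub (hP t₀)
    simp [this]
  · rw [← finrank_range_derivationsProj hY, ← finrank_range_derivationsProj hY]
    exact finrank_range_eq_of_isIdempotentElem (hP t) (hP t₀) ht

end LocallyConstant

/-! ### The Euler form on connected components of the representation varieties. -/

section Family

variable {k : Type u} [Field k] {A : Type v} [Ring A] [Algebra k A]

/-- The action of `A` on column vectors given by a point of the representation variety. -/
noncomputable def Rep.toEnd {n : ℕ} (ρ : Rep k A n) : A →ₐ[k] Module.End k (Fin n → k) :=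
  (Matrix.toLinAlgEquiv' : Matrix (Fin n) (Fin n) k ≃ₐ[k] Module.End k (Fin n → k)).toAlgHom.comp
    (show A →ₐ[k] Matrix (Fin n) (Fin n) k from ρ)

theorem Rep.toMatrix'_toEnd {n : ℕ} (ρ : Rep k A n) (a : A) (i j : Fin n) :
    LinearMap.toMatrix' (ρ.toEnd a) i j = ρ.coord k A (a, i, j) :=
  congrFun (congrFun (LinearMap.toMatrix'_toLin' _) i) j

theorem lsmul_comp_equivFun_symm (M : ModuleCat.{v} A) {n : ℕ} (b : Module.Basis (Fin n) k M)
    (a : A) : (Algebra.lsmul k k M : A →ₐ[k] Module.End k M) a ∘ₗ b.equivFun.symm =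
      b.equivFun.symm ∘ₗ (matrixRep k M b).toEnd a := by
  refine LinearMap.ext fun x => b.equivFun.injective ?_
  have h := LinearMap.toMatrix_mulVec_repr b b ((Algebra.lsmul k k M : A →ₐ[k] Module.End k M) a)
    (b.equivFun.symm x)
  have hx : ⇑(b.repr (b.equivFun.symm x)) = x := b.equivFun.apply_symm_apply x
  rw [hx] at h
  simp only [LinearMap.comp_apply, LinearEquiv.coe_coe, LinearEquiv.apply_symm_apply]
  exact h.symm

theorem equivFun_comp_lsmul (M : ModuleCat.{v} A) {n : ℕ} (b : Module.Basis (Fin n) k M)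
    (a : A) : b.equivFun ∘ₗ (Algebra.lsmul k k M : A →ₐ[k] Module.End k M) a =
      (matrixRep k M b).toEnd a ∘ₗ b.equivFun := by
  refine LinearMap.ext fun x => b.equivFun.symm.injective ?_
  have h := LinearMap.congr_fun (lsmul_comp_equivFun_symm M b a) (b.equivFun x)
  simp only [LinearMap.comp_apply, LinearEquiv.coe_coe, LinearEquiv.symm_apply_apply] at h ⊢
  exact h

theorem finrank_moduleDerivations (M N : ModuleCat.{v} A) {m n : ℕ} (b : Module.Basis (Fin m) k M)
    (c : Module.Basis (Fin n) k N) : Module.finrank k (moduleDerivations k M N) =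
      Module.finrank k (derivations (matrixRep k M b).toEnd (matrixRep k N c).toEnd) :=
  (derivationsCongr b.equivFun.symm c.equivFun (lsmul_comp_equivFun_symm M b)
    (equivFun_comp_lsmul N c)).finrank_eq

variable (k A) in
/-- The algebra of polynomial functions on the representation variety. -/
noncomputable def regularFunctions (n : ℕ) : Subalgebra k (Rep k A n → k) :=
  (MvPolynomial.aeval fun x (ρ : Rep k A n) => ρ.coord k A x).range

theorem isOpen_ne_zero_of_mem_regularFunctions {n : ℕ} {f : Rep k A n → k}
    (hf : f ∈ regularFunctions k A n) : IsOpen {ρ | f ρ ≠ 0} := by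
  obtain ⟨p, rfl⟩ := hf
  refine TopologicalSpace.isOpen_generateFrom_of_mem ⟨p, ?_⟩
  have h (ρ : Rep k A n) : (MvPolynomial.aeval fun x (ρ : Rep k A n) => ρ.coord k A x) p ρ =
      MvPolynomial.eval (ρ.coord k A) p := by
    induction p using MvPolynomial.induction_on with
    | C a => simp
    | add p q hp hq => simp [hp, hq]
    | mul_X p x hp => simp [hp]
  ext ρ
  exact not_congr (by rw [← h]; rfl)

theorem hasCoeffIn_toEnd {n : ℕ} (a : A) :
    HasCoeffIn (regularFunctions k A n) fun ρ : Rep k A n => ρ.toEnd a := fun i j =>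
  ⟨MvPolynomial.X (a, i, j), by
    ext ρ
    rw [Rep.toMatrix'_toEnd]
    simp⟩

theorem apply_eq_of_connectedComponents_mk_eq {T Z : Type*} [TopologicalSpace T] {f : T → Z}
    (hf : IsLocallyConstant f) {x y : T}
    (h : ConnectedComponents.mk x = ConnectedComponents.mk y) : f x = f y := by
  rw [ConnectedComponents.coe_eq_coe'] at h
  exact hf.apply_eq_of_isPreconnected isPreconnected_connectedComponent h mem_connectedComponent

theorem LiesIn.finite {M : ModuleCat.{v} A} {α : Comp k A} (h : LiesIn k M α) :
    Module.Finite k M := by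
  obtain ⟨b, -⟩ := h
  exact Module.Finite.of_basis b

theorem LiesIn.finrank_eq {M : ModuleCat.{v} A} {α : Comp k A} (h : LiesIn k M α) :
    Module.finrank k M = α.1 := by
  obtain ⟨b, -⟩ := h
  simpa using Module.finrank_eq_card_basis b

/-- With a basis of `N` fixed, the derivation spaces form a family over the representation variety:
the first action is tautological, the second constant. -/
theorem finrank_moduleDerivations_eq_left (hA : IsQurve k A) {S S' N : ModuleCat.{v} A}
    [Module.Finite k N] {α : Comp k A} (h : LiesIn k S α) (h' : LiesIn k S' α) :
    Module.finrank k (moduleDerivations k S N) = Module.finrank k (moduleDerivations k S' N) := by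
  obtain ⟨X, _, π, Y, hY⟩ := hA.exists_presentation
  obtain ⟨b, hb⟩ := h
  obtain ⟨b', hb'⟩ := h'
  have c := Module.finBasis k N
  rw [finrank_moduleDerivations S N b c, finrank_moduleDerivations S' N b' c]
  exact apply_eq_of_connectedComponents_mk_eq
    (isLocallyConstant_finrank_derivations (r := Rep.toEnd) (l := fun _ => (matrixRep k N c).toEnd)
      (fun f => isOpen_ne_zero_of_mem_regularFunctions) hY hasCoeffIn_toEnd
      (fun a => HasCoeffIn.const _)) (hb.trans hb'.symm)

theorem finrank_moduleDerivations_eq_right (hA : IsQurve k A) {M S S' : ModuleCat.{v} A}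
    [Module.Finite k M] {α : Comp k A} (h : LiesIn k S α) (h' : LiesIn k S' α) :
    Module.finrank k (moduleDerivations k M S) = Module.finrank k (moduleDerivations k M S') := by
  obtain ⟨X, _, π, Y, hY⟩ := hA.exists_presentation
  obtain ⟨b, hb⟩ := h
  obtain ⟨b', hb'⟩ := h'
  have c := Module.finBasis k M
  rw [finrank_moduleDerivations M S c b, finrank_moduleDerivations M S' c b']
  exact apply_eq_of_connectedComponents_mk_eq
    (isLocallyConstant_finrank_derivations (l := Rep.toEnd) (r := fun _ => (matrixRep k M c).toEnd)
      (fun f => isOpen_ne_zero_of_mem_regularFunctions) hY (fun a => HasCoeffIn.const _)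
      hasCoeffIn_toEnd) (hb.trans hb'.symm)

theorem finite_moduleDerivations (hA : IsQurve k A) (M N : ModuleCat.{v} A) [Module.Finite k M]
    [Module.Finite k N] : Module.Finite k (moduleDerivations k M N) := by
  obtain ⟨X, _, π, Y, hY⟩ := hA.exists_presentation
  exact finite_derivations hY

theorem eulerForm_eq_left (hA : IsQurve k A) {S S' N : ModuleCat.{v} A}
    [Module.Finite k N] {α : Comp k A} (h : LiesIn k S α) (h' : LiesIn k S' α) :
    eulerForm k S N = eulerForm k S' N := by
  have := h.finite
  have := h'.finite
  have := finite_moduleDerivations hA S N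
  have := finite_moduleDerivations hA S' N
  rw [eulerForm_eq, eulerForm_eq, h.finrank_eq, h'.finrank_eq,
    finrank_moduleDerivations_eq_left hA h h']

theorem eulerForm_eq_right (hA : IsQurve k A) {M S S' : ModuleCat.{v} A}
    [Module.Finite k M] {α : Comp k A} (h : LiesIn k S α) (h' : LiesIn k S' α) :
    eulerForm k M S = eulerForm k M S' := by
  have := h.finite
  have := h'.finite
  have := finite_moduleDerivations hA M S
  have := finite_moduleDerivations hA M S'
  rw [eulerForm_eq, eulerForm_eq, h.finrank_eq, h'.finrank_eq,
    finrank_moduleDerivations_eq_right hA h h']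

end Family

/-! ### Additive functions and composition factors. -/

section Additive

variable {k : Type u} [Field k] {A : Type v} [Ring A] [Algebra k A]

theorem finite_of_injective_hom {M N : ModuleCat.{v} A} [Module.Finite k N] (f : M →ₗ[A] N)
    (hf : Function.Injective f) : Module.Finite k M :=
  Module.Finite.of_injective (f.restrictScalars k) hf

theorem finite_of_surjective_hom {M N : ModuleCat.{v} A} [Module.Finite k M] (f : M →ₗ[A] N)
    (hf : Function.Surjective f) : Module.Finite k N :=
  Module.Finite.of_surjective (f.restrictScalars k) hf

variable (k) in
/-- Functions on finite dimensional modules that are additive on short exact sequences. -/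
def IsAdditive (φ : ModuleCat.{v} A → ℤ) : Prop :=
  ∀ ⦃M₁ M M₂ : ModuleCat.{v} A⦄ (i : M₁ →ₗ[A] M) (p : M →ₗ[A] M₂), Module.Finite k M →
    Function.Injective i → Function.Exact i p → Function.Surjective p → φ M = φ M₁ + φ M₂

theorem isAdditive_eulerForm_left (hA : IsQurve k A) (N : ModuleCat.{v} A) [Module.Finite k N] :
    IsAdditive k fun M => eulerForm k M N := by
  intro M₁ M M₂ i p _ hi hex hp
  have := finite_of_injective_hom (k := k) i hi
  have := finite_of_surjective_hom (k := k) p hp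
  have := finite_moduleDerivations hA M₁ N
  have := finite_moduleDerivations hA M N
  have := finite_moduleDerivations hA M₂ N
  obtain ⟨X, _, π, Y, hY⟩ := hA.exists_presentation
  have h1 : Module.finrank k M = Module.finrank k M₁ + Module.finrank k M₂ :=
    finrank_eq_add_of_exact (i := i.restrictScalars k) (p := p.restrictScalars k) hi hex hp
  have h2 : Module.finrank k (moduleDerivations k M N) =
      Module.finrank k (moduleDerivations k M₁ N) + Module.finrank k (moduleDerivations k M₂ N) :=
    finrank_derivations_left hY (i := i.restrictScalars k) (p := p.restrictScalars k)
      (fun a => by ext; simp) (fun a => by ext; simp) hi hex hp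
  simp only [eulerForm_eq, h1, h2]
  push_cast
  ring

theorem isAdditive_eulerForm_right (hA : IsQurve k A) (M : ModuleCat.{v} A) [Module.Finite k M] :
    IsAdditive k fun N => eulerForm k M N := by
  intro N₁ N N₂ i p _ hi hex hp
  have := finite_of_injective_hom (k := k) i hi
  have := finite_of_surjective_hom (k := k) p hp
  have := finite_moduleDerivations hA M N₁
  have := finite_moduleDerivations hA M N
  have := finite_moduleDerivations hA M N₂
  obtain ⟨X, _, π, Y, hY⟩ := hA.exists_presentation
  have h1 : Module.finrank k N = Module.finrank k N₁ + Module.finrank k N₂ :=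
    finrank_eq_add_of_exact (i := i.restrictScalars k) (p := p.restrictScalars k) hi hex hp
  have h2 : Module.finrank k (moduleDerivations k M N) =
      Module.finrank k (moduleDerivations k M N₁) + Module.finrank k (moduleDerivations k M N₂) :=
    finrank_derivations_right hY (i := i.restrictScalars k) (p := p.restrictScalars k)
      (fun a => by ext; simp) (fun a => by ext; simp) hi hex hp
  simp only [eulerForm_eq, h1, h2]
  push_cast
  ring

namespace IsAdditive

variable {φ : ModuleCat.{v} A → ℤ} (hφ : IsAdditive k φ)
include hφ

theorem eq_zero (M : ModuleCat.{v} A) [Subsingleton M] : φ M = 0 := by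
  have h := hφ (0 : M →ₗ[A] M) (0 : M →ₗ[A] M) inferInstance
    (Function.injective_of_subsingleton _) (fun x => by simp [Subsingleton.elim x 0])
    (Function.surjective_to_subsingleton _)
  linarith

/-- Isomorphism invariance is not built into additivity; it comes from the exact sequence `0 → M → N
→ 0 → 0`. -/
theorem congr {M N : ModuleCat.{v} A} [Module.Finite k N] (e : M ≃ₗ[A] N) : φ M = φ N := by
  have h := hφ (M₂ := ModuleCat.of A PUnit) (e : M →ₗ[A] N) 0 inferInstance e.injective
    (fun x => iff_of_true rfl (e.surjective x)) (Function.surjective_to_subsingleton (β := PUnit) _)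
  have : Subsingleton (ModuleCat.of A PUnit.{v + 1}) := inferInstanceAs (Subsingleton PUnit)
  rw [h, hφ.eq_zero (ModuleCat.of A PUnit), add_zero]

theorem pi {n : ℕ} (V : Fin n → ModuleCat.{v} A) [Module.Finite k (ModuleCat.of A (∀ i, V i))] :
    φ (ModuleCat.of A (∀ i, V i)) = ∑ i, φ (V i) := by
  induction n with
  | zero => simp [hφ.eq_zero]
  | succ n ih =>
    let p : ModuleCat.of A (∀ i, V i) →ₗ[A] ModuleCat.of A (∀ i : Fin n, V i.succ) :=
      LinearMap.pi fun i => LinearMap.proj i.succ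
    have hp : Function.Surjective p := fun x => ⟨Fin.cons 0 x, rfl⟩
    have := finite_of_surjective_hom (k := k) p hp
    rw [Fin.sum_univ_succ, ← ih fun i => V i.succ]
    refine hφ (M := ModuleCat.of A (∀ i, V i)) (LinearMap.single A (fun i => V i) 0) p inferInstance
      (Pi.single_injective (M := fun i => V i) 0) (fun x => ⟨fun hx => ⟨x 0, ?_⟩, ?_⟩) hp
    · ext i
      cases i using Fin.cases with
      | zero => simp
      | succ i => exact (congrFun hx i).symm
    · rintro ⟨y, rfl⟩
      ext i
      exact Pi.single_eq_of_ne (M := fun i => V i) (Fin.succ_ne_zero i) y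

end IsAdditive

theorem finite_pi {ι : Type*} [Finite ι] (V : ι → ModuleCat.{v} A) [∀ i, Module.Finite k (V i)]
    (W : ModuleCat.{v} A) (e : W ≃ₗ[A] ∀ i, V i) : Module.Finite k W :=
  Module.Finite.of_injective (e.toLinearMap.restrictScalars k) e.injective

theorem finite_factor {M : ModuleCat.{v} A} [Module.Finite k M]
    (s : CompositionSeries (Submodule A M)) (i : Fin s.length) :
    Module.Finite k (ModuleCat.of A (factor s i)) :=
  finite_of_surjective k (s i.succ) _ (Submodule.mkQ _) (Submodule.mkQ_surjective _)

theorem IsSemisimplification.finite {M L : ModuleCat.{v} A} [Module.Finite k M]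
    (h : IsSemisimplification M L) : Module.Finite k L := by
  obtain ⟨s, -, -, ⟨e⟩⟩ := h
  have := finite_factor (k := k) s
  exact finite_pi (fun i => ModuleCat.of A (factor s i)) L e

theorem IsAdditive.eq_of_isSemisimplification {φ : ModuleCat.{v} A → ℤ} (hφ : IsAdditive k φ)
    {M L : ModuleCat.{v} A} [Module.Finite k M] (h : IsSemisimplification M L) : φ M = φ L := by
  obtain ⟨s, h0, h1, ⟨e⟩⟩ := h
  have := finite_factor (k := k) s
  have hfin : Module.Finite k (ModuleCat.of A (∀ i, ModuleCat.of A (factor s i))) :=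
    finite_pi (fun i => ModuleCat.of A (factor s i)) _ (LinearEquiv.refl A _)
  rw [hφ.congr (N := ModuleCat.of A (∀ i, ModuleCat.of A (factor s i))) e, hφ.pi]
  let f (j : Fin (s.length + 1)) : ℤ := φ (ModuleCat.of A (s j))
  have hf (i : Fin s.length) :
      f i.succ = f i.castSucc + φ (ModuleCat.of A (factor s i)) := by
    have hle : s i.castSucc ≤ s i.succ := CovBy.le (s.step i)
    refine hφ (M := ModuleCat.of A (s i.succ)) (Submodule.inclusion hle) (Submodule.mkQ _)
      (finite_of_injective_hom (Submodule.subtype _) Subtype.val_injective)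
      (Submodule.inclusion_injective hle) (fun x => ?_) (Submodule.mkQ_surjective _)
    rw [Submodule.mkQ_apply, Submodule.Quotient.mk_eq_zero]
    exact ⟨fun hx => ⟨⟨x.1, hx⟩, rfl⟩, by rintro ⟨y, rfl⟩; exact y.2⟩
  have hlast : f (Fin.last _) = φ M := by
    refine hφ.congr ((LinearEquiv.ofEq _ _ ?_).trans Submodule.topEquiv)
    exact h1
  have hzero : f 0 = 0 := by
    have : s 0 = ⊥ := h0
    have : Subsingleton (ModuleCat.of A (s 0)) := by
      change Subsingleton (s 0)
      rw [this]
      infer_instance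
    exact hφ.eq_zero _
  -- Telescoping: the sum of `f` is expanded both by its first and by its last term, and the common
  -- part is cancelled.
  have hsum := Fin.sum_univ_succ f
  rw [Fin.sum_univ_castSucc f, hlast, hzero, zero_add] at hsum
  simp only [hf, Finset.sum_add_distrib] at hsum
  exact add_left_cancel hsum

theorem IsAdditive.eq_sum_of_hasRepType {φ : ModuleCat.{v} A → ℤ} (hφ : IsAdditive k φ)
    {c : Comp k A → ℤ}
    (hc : ∀ (S : ModuleCat.{v} A) (β : Comp k A), IsSimpleModule A S → LiesIn k S β → φ S = c β)
    {M : ModuleCat.{v} A} [Module.Finite k M] {τ : Multiset (ℕ × Comp k A)}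
    (h : HasRepType k M τ) : φ M = (τ.map fun p => (p.1 : ℤ) * c p.2).sum := by
  obtain ⟨r, S, e, β, hS, -, -, hβ, hss, rfl⟩ := h
  have hfinS (i) : Module.Finite k (S i) := (hβ i).finite
  have hfin (i) : Module.Finite k (ModuleCat.of A (Fin (e i) → S i)) :=
    finite_pi (fun _ => S i) _ (LinearEquiv.refl A _)
  have hfin' : Module.Finite k (ModuleCat.of A (∀ i, ModuleCat.of A (Fin (e i) → S i))) :=
    finite_pi (fun i => ModuleCat.of A (Fin (e i) → S i)) _ (LinearEquiv.refl A _)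
  rw [hφ.eq_of_isSemisimplification hss]
  refine (hφ.pi fun i => ModuleCat.of A (Fin (e i) → S i)).trans ?_
  rw [Multiset.map_map]
  refine Finset.sum_congr rfl fun i _ => ?_
  have := hfin i
  refine (hφ.pi fun _ : Fin (e i) => S i).trans ?_
  simp [hc (S i) (β i) (hS i) (hβ i)]

theorem IsAdditive.eq_of_hasRepType {φ : ModuleCat.{v} A → ℤ} (hφ : IsAdditive k φ)
    (hc : ∀ (S S' : ModuleCat.{v} A) (β : Comp k A), LiesIn k S β → LiesIn k S' β → φ S = φ S')
    {M M' : ModuleCat.{v} A} [Module.Finite k M] [Module.Finite k M']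
    {τ : Multiset (ℕ × Comp k A)} (h : HasRepType k M τ) (h' : HasRepType k M' τ) : φ M = φ M' := by
  classical
  -- The value on a component is read off from any module in it; the default `0` occurs only for
  -- components containing none.
  let c (β : Comp k A) : ℤ := if hβ : ∃ S : ModuleCat.{v} A, LiesIn k S β then φ hβ.choose else 0
  have hφc (S : ModuleCat.{v} A) (β : Comp k A) (_ : IsSimpleModule A S) (hS : LiesIn k S β) :
      φ S = c β := by
    have hβ : ∃ S : ModuleCat.{v} A, LiesIn k S β := ⟨S, hS⟩
    simp only [c, dif_pos hβ]
    exact hc _ _ β hS hβ.choose_spec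
  rw [hφ.eq_sum_of_hasRepType hφc h, hφ.eq_sum_of_hasRepType hφc h']

end Additive

end Qurve

theorem mainTheorem8 {k : Type u} [Field k] [IsAlgClosed k] {A : Type v} [Ring A] [Algebra k A]
    (hA : Qurve.IsQurve k A) :
    (∀ M N : ModuleCat.{v} A, Module.Finite k M → Module.Finite k N →
      Module.Finite k (M ⟶ N) ∧ Module.Finite k (Abelian.Ext M N 1)) ∧
    (∀ M M' N N' : ModuleCat.{v} A,
      Module.Finite k M → Module.Finite k M' → Module.Finite k N → Module.Finite k N' →
      ∀ σ τ : Multiset (ℕ × Qurve.Comp k A),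
        Qurve.HasRepType k M σ → Qurve.HasRepType k M' σ →
        Qurve.HasRepType k N τ → Qurve.HasRepType k N' τ →
        Qurve.eulerForm k M N = Qurve.eulerForm k M' N') ∧
    (∀ S S' T T' : ModuleCat.{v} A,
      IsSimpleModule A S → IsSimpleModule A S' → IsSimpleModule A T → IsSimpleModule A T' →
      ∀ α β : Qurve.Comp k A,
        Qurve.LiesIn k S α → Qurve.LiesIn k S' α → Qurve.LiesIn k T β → Qurve.LiesIn k T' β →
        Qurve.eulerForm k S T = Qurve.eulerForm k S' T') ∧
    (∀ M N L K : ModuleCat.{v} A, Module.Finite k M → Module.Finite k N →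
      Qurve.IsSemisimplification M L → Qurve.IsSemisimplification N K →
      Qurve.eulerForm k M N = Qurve.eulerForm k L K) := by
  refine ⟨fun M N _ _ => ?_, ?_, ?_, ?_⟩
  · have := Qurve.finite_moduleDerivations hA M N
    exact ⟨Qurve.finite_hom M N, Qurve.finite_ext M N⟩
  · intro M M' N N' _ _ _ _ σ τ hM hM' hN hN'
    -- One argument is exchanged at a time: `M` for `M'` against `N`, then `N` for `N'` against
    -- `M'`.
    exact ((Qurve.isAdditive_eulerForm_left hA N).eq_of_hasRepType
      (fun _ _ _ h h' => Qurve.eulerForm_eq_left hA h h') hM hM').trans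
      ((Qurve.isAdditive_eulerForm_right hA M').eq_of_hasRepType
        (fun _ _ _ h h' => Qurve.eulerForm_eq_right hA h h') hN hN')
  · intro S S' T T' _ _ _ _ α β hS hS' hT hT'
    have := hT.finite
    have := hS'.finite
    exact (Qurve.eulerForm_eq_left hA hS hS').trans (Qurve.eulerForm_eq_right hA hT hT')
  · intro M N L K _ _ hL hK
    have := hL.finite (k := k)
    exact ((Qurve.isAdditive_eulerForm_left hA N).eq_of_isSemisimplification hL).trans
      ((Qurve.isAdditive_eulerForm_right hA L).eq_of_isSemisimplification hK)
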